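/- For integers $q\ge 2$, $m\ge 1$ and a real number $d$, let $A_q(m,d)$ be the maximum size of a code $C\subseteq[q]^m$ in which any two distinct codewords have Hamming distance at least $d$, i.e. differ in at least $d$ coordinates. Let $k$ be a positive integer. (1) For every integer $q\ge 2$ there is a constant $C=C(q,k)$ such that for every integer $r\ge 1$ and every real $j\le\sqrt{(k-1)r/(q-1)}$, $$A_q\bigl(r,(1-1/q)(r-j)\bigr)\le C\,r^{k}.$$ (2) For every prime power $q$ there are infinitely many positive integers $r$ such that, for every real $j\ge(k-1)\sqrt{r/q}$, $$A_q\bigl(r,(1-1/q)(r-j)\bigr)\ge (rq)^{k/2}.$$ -/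

import Mathlib

/-- `C ⊆ [q]^m` is a code in which any two distinct codewords have Hamming distance at least `d`.
The bound `d` is a real number, since it need not be an integer. -/
def IsCodeWithDist (q m : ℕ) (d : ℝ) (C : Finset (Fin m → Fin q)) : Prop :=
  ∀ x ∈ C, ∀ y ∈ C, x ≠ y → d ≤ (hammingDist x y : ℝ)

/-- `A_q(m, d)`: the maximum size of a `q`-ary code of length `m` in which any two distinct
codewords have Hamming distance at least `d`. -/
noncomputable def maxCodeSize (q m : ℕ) (d : ℝ) : ℕ :=
  sSup {N : ℕ | ∃ C : Finset (Fin m → Fin q), IsCodeWithDist q m d C ∧ C.card = N}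

/-- The supremum in `maxCodeSize` is a genuine maximum. -/
theorem maxCodeSize_isGreatest (q m : ℕ) (d : ℝ) :
    IsGreatest {N : ℕ | ∃ C : Finset (Fin m → Fin q), IsCodeWithDist q m d C ∧ C.card = N}
      (maxCodeSize q m d) := by
  have hb : BddAbove
      {N : ℕ | ∃ C : Finset (Fin m → Fin q), IsCodeWithDist q m d C ∧ C.card = N} := by
    refine ⟨Fintype.card (Fin m → Fin q), ?_⟩
    rintro N ⟨C, -, rfl⟩
    exact Finset.card_le_univ C
  exact ⟨Nat.sSup_mem ⟨0, ∅, by simp [IsCodeWithDist], rfl⟩ hb, fun N hN => le_csSup hb hN⟩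

/-! The upper bound is Delsarte's linear programming method. With `T` the sum of the agreement
kernels, the distance condition forces `T ≤ A` at distinct codewords, where `A² = (k - 1) * r * (q -
1)`, and `T ≥ -r` always. So `Φ = (T - A) * (T + r) * g²` is nonpositive there for every `g`. For `g
= testKernel`, the Krawtchouk recurrence `sum_mul_intEsymm` shows that `(T - A) * g` and `(T + r) *
g` both exceed `k * E_k` by a Gram kernel. By Schur's product theorem `Φ` exceeds `k² * E_k²` by a
Gram kernel, and `E_k²` has constant part `r.choose k * (q - 1) ^ k`, of order `r ^ k`. The diagonal
of `Φ` is of order `r ^ (2 * k)`; the ratio gives `r ^ k`.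

The lower bound concatenates Reed–Solomon codes of degree `< k` over a field of order `q ^ (l + 1)`
with affine functions on `F ^ l`, at length `r = q ^ (2 * l + 1)`. Then `√(r / q) = q ^ l` and `r *
q = (q ^ (l + 1))²`. -/

/-! ### Positive semidefinite kernels. -/

/-- The kernels `K(x, y) = ∑ t, φ t x * φ t y` on `X`, as a subsemiring of the functions on
`X × X`. Closure under products is the Schur product theorem. -/
def gramKernels (X : Type*) : Subsemiring (X × X → ℝ) where
  carrier := {K | ∃ (ι : Type) (_ : Fintype ι) (φ : ι → X → ℝ),
    ∀ p, K p = ∑ t, φ t p.1 * φ t p.2}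
  zero_mem' := ⟨Empty, inferInstance, fun _ _ => 0, by simp⟩
  one_mem' := ⟨Unit, inferInstance, fun _ _ => 1, by simp⟩
  add_mem' := by
    rintro K L ⟨ι, _, φ, hφ⟩ ⟨κ, _, ψ, hψ⟩
    exact ⟨ι ⊕ κ, inferInstance, Sum.elim φ ψ, fun p => by simp [hφ, hψ]⟩
  mul_mem' := by
    rintro K L ⟨ι, _, φ, hφ⟩ ⟨κ, _, ψ, hψ⟩
    refine ⟨ι × κ, inferInstance, fun t x => φ t.1 x * ψ t.2 x, fun p => ?_⟩
    rw [Pi.mul_apply, hφ, hψ, Finset.sum_mul_sum, Fintype.sum_prod_type]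
    exact Finset.sum_congr rfl fun i _ => Finset.sum_congr rfl fun j _ => by ring

namespace gramKernels

variable {X : Type*}

theorem smul_mem {c : ℝ} (hc : 0 ≤ c) {K : X × X → ℝ} (hK : K ∈ gramKernels X) :
    c • K ∈ gramKernels X := by
  obtain ⟨ι, _, φ, hφ⟩ := hK
  refine ⟨ι, inferInstance, fun t x => √c * φ t x, fun p => ?_⟩
  rw [Pi.smul_apply, hφ, smul_eq_mul, Finset.mul_sum]
  refine Finset.sum_congr rfl fun i _ => ?_
  linear_combination (-(φ i p.1 * φ i p.2)) * Real.mul_self_sqrt hc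

/-- The double sum is `∑ t, (∑ x ∈ C, φ t x) ^ 2`. -/
theorem sum_nonneg {K : X × X → ℝ} (hK : K ∈ gramKernels X) (C : Finset X) :
    0 ≤ ∑ x ∈ C, ∑ y ∈ C, K (x, y) := by
  obtain ⟨ι, _, φ, hφ⟩ := hK
  have h : ∑ x ∈ C, ∑ y ∈ C, K (x, y) = ∑ t, (∑ x ∈ C, φ t x) * ∑ y ∈ C, φ t y := by
    simp only [hφ, Finset.sum_mul_sum]
    rw [Finset.sum_comm' (t' := C) (s' := fun _ => C) (by tauto)]
    rw [Finset.sum_comm]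
    simp only [Finset.sum_comm (s := C) (t := Finset.univ)]
  rw [h]
  exact Finset.sum_nonneg fun t _ => mul_self_nonneg _

end gramKernels

/-! ### Krawtchouk polynomials as elementary symmetric functions. -/

section Esymm

variable {ι R : Type*} [CommRing R]

/-- The elementary symmetric polynomial of integer degree `m` in the `y i`, `i ∈ s`;
it vanishes for `m < 0`. -/
def intEsymm (y : ι → R) (s : Finset ι) (m : ℤ) : R :=
  ∑ S ∈ s.powerset with (S.card : ℤ) = m, ∏ i ∈ S, y i

theorem intEsymm_of_neg (y : ι → R) (s : Finset ι) {m : ℤ} (hm : m < 0) :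
    intEsymm y s m = 0 := by
  rw [intEsymm, Finset.filter_false_of_mem, Finset.sum_empty]
  intro S _ h
  omega

theorem intEsymm_natCast (y : ι → R) (s : Finset ι) (m : ℕ) :
    intEsymm y s m = ∑ S ∈ s.powersetCard m, ∏ i ∈ S, y i := by
  rw [intEsymm]
  congr 1
  ext S
  simp [Finset.mem_powersetCard]

theorem intEsymm_empty (y : ι → R) (m : ℤ) :
    intEsymm y ∅ m = if m = 0 then 1 else 0 := by
  simp [intEsymm, Finset.sum_filter, eq_comm]

theorem intEsymm_insert [DecidableEq ι] (y : ι → R) {s : Finset ι} {a : ι} (ha : a ∉ s) (m : ℤ) :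
    intEsymm y (insert a s) m = intEsymm y s m + y a * intEsymm y s (m - 1) := by
  simp only [intEsymm, Finset.sum_filter]
  rw [Finset.sum_powerset_insert ha, Finset.mul_sum]
  congr 1
  refine Finset.sum_congr rfl fun S hS => ?_
  have haS : a ∉ S := fun h => ha (Finset.mem_powerset.1 hS h)
  rw [Finset.card_insert_of_notMem haS, Finset.prod_insert haS]
  push_cast
  have : ((S.card : ℤ) + 1 = m) ↔ ((S.card : ℤ) = m - 1) := by omega
  simp only [this, mul_ite, mul_zero]

/-- The three-term recurrence of the Krawtchouk polynomials. -/
theorem sum_mul_intEsymm [DecidableEq ι] {y : ι → R} {b c : R} (hy : ∀ i, y i ^ 2 = b * y i + c)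
    (s : Finset ι) (m : ℤ) :
    (∑ i ∈ s, y i) * intEsymm y s m = ((m : R) + 1) * intEsymm y s (m + 1)
      + b * m * intEsymm y s m + c * ((s.card : R) - m + 1) * intEsymm y s (m - 1) := by
  induction s using Finset.induction_on generalizing m with
  | empty =>
    simp only [intEsymm_empty, Finset.sum_empty, zero_mul, Finset.card_empty]
    -- These are the degrees at which some term is nonzero on the empty set; in each, its
    -- coefficient vanishes.
    rcases eq_or_ne m (-1) with rfl | h1
    · simp
    rcases eq_or_ne m 0 with rfl | h2
    · simp
    rcases eq_or_ne m 1 with rfl | h3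
    · simp
    rw [if_neg (by omega), if_neg (by omega), if_neg (by omega)]
    simp
  | insert a s ha ih =>
    have h1 := ih m
    have h2 := ih (m - 1)
    rw [Finset.sum_insert ha, Finset.card_insert_of_notMem ha, intEsymm_insert y ha,
      intEsymm_insert y ha, intEsymm_insert y ha, show m + 1 - 1 = m by ring]
    rw [show m - 1 + 1 = m by ring] at h2
    push_cast at h1 h2 ⊢
    linear_combination h1 + y a * h2 + intEsymm y s (m - 1) * hy a

end Esymm

/-! ### Agreement kernels on words. -/

section Agreement

variable {q r : ℕ}

/-- The kernel equal to `q - 1` where the words agree at `i` and to `-1` where they differ. -/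
def agreementKernel (q r : ℕ) (i : Fin r) (p : (Fin r → Fin q) × (Fin r → Fin q)) : ℝ :=
  if p.1 i = p.2 i then (q : ℝ) - 1 else -1

/-- The values `q - 1` and `-1` are the roots of `y² = (q - 2) * y + (q - 1)`. -/
theorem agreementKernel_sq (i : Fin r) :
    agreementKernel q r i ^ 2
      = (fun _ => (q : ℝ) - 2) * agreementKernel q r i + fun _ => (q : ℝ) - 1 := by
  ext p
  by_cases h : p.1 i = p.2 i <;> simp [agreementKernel, h] <;> ring

/-- Up to the factor `q`, this is the Gram matrix of a centred simplex: letters are sent to basis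
vectors minus their mean. -/
theorem agreementKernel_mem (hq : 2 ≤ q) (i : Fin r) :
    agreementKernel q r i ∈ gramKernels (Fin r → Fin q) := by
  have hq0 : (q : ℝ) ≠ 0 := by positivity
  have h : (q : ℝ) • (fun p : (Fin r → Fin q) × (Fin r → Fin q) =>
      ∑ a : Fin q, ((if p.1 i = a then (1 : ℝ) else 0) - 1 / q)
        * ((if p.2 i = a then (1 : ℝ) else 0) - 1 / q)) ∈ gramKernels (Fin r → Fin q) :=
    gramKernels.smul_mem (by positivity) ⟨Fin q, inferInstance,
      fun a x => (if x i = a then (1 : ℝ) else 0) - 1 / q, fun p => rfl⟩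
  convert h using 1
  ext p
  simp only [agreementKernel, Pi.smul_apply, smul_eq_mul, sub_mul, mul_sub,
    Finset.sum_sub_distrib]
  by_cases h : p.1 i = p.2 i
  · simp [h]
    field_simp
    ring
  · simp [h]
    field_simp
    ring

theorem sum_agreementKernel (p : (Fin r → Fin q) × (Fin r → Fin q)) :
    (∑ i, agreementKernel q r i) p = ((q : ℝ) - 1) * r - q * hammingDist p.1 p.2 := by
  have h : ∀ i, agreementKernel q r i p
      = ((q : ℝ) - 1) - q * (if p.1 i ≠ p.2 i then 1 else 0) := by
    intro i
    by_cases h : p.1 i = p.2 i <;> simp [agreementKernel, h]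
  simp only [Finset.sum_apply, h, Finset.sum_sub_distrib, ← Finset.mul_sum, hammingDist,
    Finset.sum_boole]
  simp
  ring

theorem intEsymm_agreementKernel_mem (hq : 2 ≤ q) (m : ℤ) :
    intEsymm (agreementKernel q r) Finset.univ m ∈ gramKernels (Fin r → Fin q) :=
  sum_mem fun _ _ => prod_mem fun i _ => agreementKernel_mem hq i

/-- The constant coefficient of `(∏ i ∈ S, agreementKernel q r i) ^ 2` is `(q - 1) ^ #S`. -/
theorem prod_agreementKernel_sq_sub_mem (hq : 2 ≤ q) (S : Finset (Fin r)) :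
    (∏ i ∈ S, agreementKernel q r i) ^ 2 - (fun _ => ((q : ℝ) - 1) ^ S.card)
      ∈ gramKernels (Fin r → Fin q) := by
  have hq' : (2 : ℝ) ≤ q := by exact_mod_cast hq
  induction S using Finset.induction_on with
  | empty =>
    convert zero_mem (gramKernels (Fin r → Fin q)) using 1
    ext; simp
  | insert a S ha ih =>
    have h1 : (∏ i ∈ S, agreementKernel q r i) ^ 2 ∈ gramKernels (Fin r → Fin q) :=
      pow_mem (prod_mem fun i _ => agreementKernel_mem hq i) 2
    have h2 : (((q : ℝ) - 2) • agreementKernel q r a) * (∏ i ∈ S, agreementKernel q r i) ^ 2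
        + ((q : ℝ) - 1) • ((∏ i ∈ S, agreementKernel q r i) ^ 2
          - (fun _ => ((q : ℝ) - 1) ^ S.card)) ∈ gramKernels (Fin r → Fin q) :=
      add_mem (mul_mem (gramKernels.smul_mem (by linarith) (agreementKernel_mem hq a)) h1)
        (gramKernels.smul_mem (by linarith) ih)
    convert h2 using 1
    rw [Finset.prod_insert ha, Finset.card_insert_of_notMem ha, mul_pow, agreementKernel_sq]
    ext p
    simp
    ring

/-- Expand the square over pairs `S`, `U`: each diagonal pair contributes the constant `(q - 1) ^
k`, and the off-diagonal products are Gram kernels. -/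
theorem intEsymm_agreementKernel_sq_sub_mem (hq : 2 ≤ q) (k : ℕ) :
    intEsymm (agreementKernel q r) Finset.univ k ^ 2
      - (fun _ => (r.choose k : ℝ) * ((q : ℝ) - 1) ^ k) ∈ gramKernels (Fin r → Fin q) := by
  set δ := fun S : Finset (Fin r) => ∏ i ∈ S, agreementKernel q r i with hδ
  have hmem : ∀ S, δ S ∈ gramKernels (Fin r → Fin q) := fun S =>
    prod_mem fun i _ => agreementKernel_mem hq i
  have h : ∑ S ∈ Finset.univ.powersetCard k, ((δ S ^ 2 - fun _ => ((q : ℝ) - 1) ^ S.card)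
      + ∑ U ∈ (Finset.univ.powersetCard k).erase S, δ S * δ U)
      ∈ gramKernels (Fin r → Fin q) :=
    sum_mem fun S _ => add_mem (prod_agreementKernel_sq_sub_mem hq S)
      (sum_mem fun U _ => mul_mem (hmem S) (hmem U))
  convert h using 1
  have h1 : ∀ S ∈ (Finset.univ : Finset (Fin r)).powersetCard k,
      (δ S ^ 2 - fun _ => ((q : ℝ) - 1) ^ S.card)
        + ∑ U ∈ (Finset.univ.powersetCard k).erase S, δ S * δ U
      = (∑ U ∈ Finset.univ.powersetCard k, δ S * δ U) - fun _ => ((q : ℝ) - 1) ^ k := by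
    intro S hS
    rw [← Finset.add_sum_erase _ _ hS, (Finset.mem_powersetCard.1 hS).2]
    ring
  rw [Finset.sum_congr rfl h1, Finset.sum_sub_distrib, ← Finset.sum_mul_sum,
    intEsymm_natCast, sq]
  congr 1
  rw [Finset.sum_const, Finset.card_powersetCard, Finset.card_univ, Fintype.card_fin]
  ext
  simp

theorem intEsymm_agreementKernel_diag_le (hq : 2 ≤ q) (hr : 1 ≤ r) (x : Fin r → Fin q)
    {m : ℤ} {M : ℕ} (h : m ≤ M) :
    intEsymm (agreementKernel q r) Finset.univ m (x, x) ≤ ((r : ℝ) * ((q : ℝ) - 1)) ^ M := by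
  have hq' : (2 : ℝ) ≤ q := by exact_mod_cast hq
  have hr' : (1 : ℝ) ≤ r := by exact_mod_cast hr
  have hn : 1 ≤ (r : ℝ) * ((q : ℝ) - 1) := by nlinarith
  rcases lt_or_ge m 0 with hm | hm
  · rw [intEsymm_of_neg _ _ hm]
    simp only [Pi.zero_apply]
    positivity
  lift m to ℕ using hm
  have h1 : intEsymm (agreementKernel q r) Finset.univ m (x, x)
      = (r.choose m : ℝ) * ((q : ℝ) - 1) ^ m := by
    rw [intEsymm_natCast, Finset.sum_apply, Finset.sum_congr rfl
      (g := fun _ => ((q : ℝ) - 1) ^ m)]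
    · simp
    · intro S hS
      rw [Finset.prod_apply, Finset.prod_congr rfl (g := fun _ => (q : ℝ) - 1),
        Finset.prod_const, (Finset.mem_powersetCard.1 hS).2]
      intro i _
      simp [agreementKernel]
  rw [h1]
  calc (r.choose m : ℝ) * ((q : ℝ) - 1) ^ m ≤ (r : ℝ) ^ m * ((q : ℝ) - 1) ^ m := by
        have : (0 : ℝ) ≤ (q : ℝ) - 1 := by linarith
        gcongr
        exact_mod_cast Nat.choose_le_pow r m
    _ = ((r : ℝ) * ((q : ℝ) - 1)) ^ m := (mul_pow _ _ _).symm
    _ ≤ _ := pow_le_pow_right₀ hn (by exact_mod_cast h)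

end Agreement

/-! ### The linear programming upper bound. -/

section UpperBound

/-- The linear programming bound: if `Φ - e` is a Gram kernel and `Φ` is nonpositive at pairs of
distinct codewords, then the size of the code is at most the ratio of the diagonal value to `e`. -/
theorem card_mul_le_of_gramKernel {X : Type*} {Φ : X × X → ℝ} {e b : ℝ}
    (hΦ : Φ - (fun _ => e) ∈ gramKernels X) (hb : 0 ≤ b) {C : Finset X}
    (hoff : ∀ x ∈ C, ∀ y ∈ C, x ≠ y → Φ (x, y) ≤ 0) (hdiag : ∀ x ∈ C, Φ (x, x) ≤ b) :
    C.card * e ≤ b := by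
  classical
  have h1 := gramKernels.sum_nonneg hΦ C
  have h2 : ∑ x ∈ C, ∑ y ∈ C, Φ (x, y) ≤ C.card * b := by
    rw [← nsmul_eq_mul]
    refine Finset.sum_le_card_nsmul _ _ _ fun x hx => ?_
    rw [← Finset.add_sum_erase _ _ hx]
    have : ∑ y ∈ C.erase x, Φ (x, y) ≤ 0 := Finset.sum_nonpos fun y hy =>
      hoff x hx y (Finset.mem_of_mem_erase hy) (Finset.ne_of_mem_erase hy).symm
    linarith [hdiag x hx]
  simp only [Pi.sub_apply, Finset.sum_sub_distrib, Finset.sum_const, nsmul_eq_mul] at h1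
  rcases C.eq_empty_or_nonempty with rfl | ⟨x, hx⟩
  · simpa using hb
  · have hC : (0 : ℝ) < C.card := by exact_mod_cast Finset.card_pos.2 ⟨x, hx⟩
    have : (C.card : ℝ) * (C.card * e) ≤ C.card * b := by linarith
    exact le_of_mul_le_mul_left this hC

variable {q r : ℕ}

/-- Coefficients at negative degrees may have either sign, which spares a case split for small `k`.
-/
theorem smul_intEsymm_agreementKernel_mem (hq : 2 ≤ q) {a : ℝ} {m : ℤ} (h : 0 ≤ m → 0 ≤ a) :
    a • intEsymm (agreementKernel q r) Finset.univ m ∈ gramKernels (Fin r → Fin q) := by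
  rcases lt_or_ge m 0 with hm | hm
  · rw [intEsymm_of_neg _ _ hm, smul_zero]
    exact zero_mem _
  · exact gramKernels.smul_mem (h hm) (intEsymm_agreementKernel_mem hq m)

theorem sum_agreementKernel_mul_intEsymm (p : (Fin r → Fin q) × (Fin r → Fin q)) (m : ℤ) :
    (∑ i, agreementKernel q r i) p * intEsymm (agreementKernel q r) Finset.univ m p
      = ((m : ℝ) + 1) * intEsymm (agreementKernel q r) Finset.univ (m + 1) p
        + ((q : ℝ) - 2) * m * intEsymm (agreementKernel q r) Finset.univ m p
        + ((q : ℝ) - 1) * ((r : ℝ) - m + 1)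
          * intEsymm (agreementKernel q r) Finset.univ (m - 1) p := by
  have h := congrFun (sum_mul_intEsymm (agreementKernel_sq (q := q) (r := r)) Finset.univ m) p
  simpa using h

/-- The test kernel of the linear programming bound is the square of this one, times
`(T - A) * (T + r)`, where `T = ∑ i, agreementKernel q r i`. -/
noncomputable def testKernel (q r k : ℕ) (c : ℝ) : (Fin r → Fin q) × (Fin r → Fin q) → ℝ :=
  intEsymm (agreementKernel q r) Finset.univ (k - 1)
    + c • intEsymm (agreementKernel q r) Finset.univ (k - 2)
    + ((q : ℝ) - 1) • intEsymm (agreementKernel q r) Finset.univ (k - 3)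

theorem testKernel_diag_le (hq : 2 ≤ q) (hr : 1 ≤ r) {k : ℕ} {c : ℝ}
    (hk : 1 ≤ k) (hc : c ≤ (r : ℝ) * ((q : ℝ) - 1)) (hc0 : 0 ≤ c) (x : Fin r → Fin q) :
    testKernel q r k c (x, x) ≤ 3 * ((r : ℝ) * ((q : ℝ) - 1)) ^ (k - 1) := by
  have hq' : (2 : ℝ) ≤ q := by exact_mod_cast hq
  have hr' : (1 : ℝ) ≤ r := by exact_mod_cast hr
  have hn : (q : ℝ) - 1 ≤ (r : ℝ) * ((q : ℝ) - 1) := by nlinarith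
  have h1 := intEsymm_agreementKernel_diag_le hq hr x (m := k - 1) (M := k - 1) (by omega)
  have key : ∀ (m : ℤ) (a : ℝ), m ≤ k - 2 → 0 ≤ a → a ≤ (r : ℝ) * ((q : ℝ) - 1) →
      a * intEsymm (agreementKernel q r) Finset.univ m (x, x)
        ≤ ((r : ℝ) * ((q : ℝ) - 1)) ^ (k - 1) := by
    intro m a hm ha ha'
    rcases lt_or_ge m 0 with hm0 | hm0
    · rw [intEsymm_of_neg _ _ hm0]
      simp only [Pi.zero_apply, mul_zero]
      exact pow_nonneg (by linarith) _
    · have h := intEsymm_agreementKernel_diag_le hq hr x (m := m) (M := k - 2) (by omega)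
      calc a * intEsymm (agreementKernel q r) Finset.univ m (x, x)
          ≤ a * ((r : ℝ) * ((q : ℝ) - 1)) ^ (k - 2) := mul_le_mul_of_nonneg_left h ha
        _ ≤ ((r : ℝ) * ((q : ℝ) - 1)) * ((r : ℝ) * ((q : ℝ) - 1)) ^ (k - 2) :=
          mul_le_mul_of_nonneg_right ha' (pow_nonneg (by linarith) _)
        _ = _ := by rw [← pow_succ', show k - 2 + 1 = k - 1 by omega]
  have h2 := key (k - 2) c le_rfl hc0 hc
  have h3 := key (k - 3) ((q : ℝ) - 1) (by omega) (by linarith) hn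
  simp only [testKernel, Pi.add_apply, Pi.smul_apply, smul_eq_mul]
  linarith

theorem testKernel_mem (hq : 2 ≤ q) (k : ℕ) {c : ℝ} (hc0 : 0 ≤ c) :
    testKernel q r k c ∈ gramKernels (Fin r → Fin q) := by
  have hq' : (2 : ℝ) ≤ q := by exact_mod_cast hq
  exact add_mem (add_mem (intEsymm_agreementKernel_mem hq _)
    (gramKernels.smul_mem hc0 (intEsymm_agreementKernel_mem hq _)))
    (gramKernels.smul_mem (by linarith) (intEsymm_agreementKernel_mem hq _))

/-- The recurrence leaves nonnegative coefficients. In degree `k - 1`, `c * (k - 1)` cancels `-A`.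
In degree `k - 2`, the last summand of `testKernel` restores the full `r * (q - 1)`, which absorbs
`c * A`. In degree `k - 3`, `c * (r - 2 * k + 4)` appears, whence `2 * k ≤ r`. -/
theorem sub_mul_testKernel_sub_mem (hq : 2 ≤ q) {k : ℕ} (hk : 1 ≤ k) (hr : 2 * k ≤ r) {A c : ℝ}
    (hc0 : 0 ≤ c) (hcA : c * ((k : ℝ) - 1) = A) (hA : c * A ≤ (r : ℝ) * ((q : ℝ) - 1)) :
    (∑ i, agreementKernel q r i - fun _ => A) * testKernel q r k c
      - (k : ℝ) • intEsymm (agreementKernel q r) Finset.univ k ∈ gramKernels (Fin r → Fin q) := by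
  have hq' : (2 : ℝ) ≤ q := by exact_mod_cast hq
  have hk' : (1 : ℝ) ≤ k := by exact_mod_cast hk
  have hr' : 2 * (k : ℝ) ≤ r := by exact_mod_cast hr
  have h1 := smul_intEsymm_agreementKernel_mem (r := r) hq (m := k - 1)
    (a := ((q : ℝ) - 2) * ((k : ℝ) - 1))
    (fun _ => mul_nonneg (by linarith) (by linarith))
  have h2 := smul_intEsymm_agreementKernel_mem (r := r) hq (m := k - 2)
    (a := ((r : ℝ) * ((q : ℝ) - 1) - c * A) + c * ((q : ℝ) - 2) * ((k : ℝ) - 2))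
    (fun h => by
      have h2k : (2 : ℝ) ≤ k := by
        have : 2 ≤ k := by omega
        exact_mod_cast this
      exact add_nonneg (by linarith)
        (mul_nonneg (mul_nonneg hc0 (by linarith)) (by linarith)))
  have h3 := smul_intEsymm_agreementKernel_mem (r := r) hq (m := k - 3)
    (a := ((q : ℝ) - 1) * (c * ((r : ℝ) - k + 3) - A + ((q : ℝ) - 2) * ((k : ℝ) - 3)))
    (fun h => by
      have h3k : (3 : ℝ) ≤ k := by
        have : 3 ≤ k := by omega
        exact_mod_cast this
      refine mul_nonneg (by linarith) (add_nonneg ?_ (mul_nonneg (by linarith) (by linarith)))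
      rw [← hcA, ← mul_sub]
      exact mul_nonneg hc0 (by linarith))
  have h4 := smul_intEsymm_agreementKernel_mem (r := r) hq (m := k - 4)
    (a := ((q : ℝ) - 1) * (((q : ℝ) - 1) * ((r : ℝ) - k + 4)))
    (fun _ => mul_nonneg (by linarith) (mul_nonneg (by linarith) (by linarith)))
  convert add_mem (add_mem (add_mem h1 h2) h3) h4 using 1
  ext p
  have e1 := sum_agreementKernel_mul_intEsymm (q := q) (r := r) p (k - 1)
  have e2 := sum_agreementKernel_mul_intEsymm (q := q) (r := r) p (k - 2)
  have e3 := sum_agreementKernel_mul_intEsymm (q := q) (r := r) p (k - 3)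
  rw [show (k : ℤ) - 1 + 1 = k by ring, show (k : ℤ) - 1 - 1 = k - 2 by ring] at e1
  rw [show (k : ℤ) - 2 + 1 = k - 1 by ring, show (k : ℤ) - 2 - 1 = k - 3 by ring] at e2
  rw [show (k : ℤ) - 3 + 1 = k - 2 by ring, show (k : ℤ) - 3 - 1 = k - 4 by ring] at e3
  push_cast at e1 e2 e3
  simp only [testKernel, Pi.sub_apply, Pi.mul_apply, Pi.add_apply, Pi.smul_apply, smul_eq_mul]
  linear_combination e1 + c * e2 + ((q : ℝ) - 1) * e3
    + intEsymm (agreementKernel q r) Finset.univ (k - 1) p * hcA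

/-- Only `T * E_(k-1)` needs the recurrence, to isolate `k * E_k`; everything else is a sum or
product of Gram kernels. -/
theorem add_mul_testKernel_sub_mem (hq : 2 ≤ q) {k : ℕ} (hk : 1 ≤ k) (hr : k ≤ r) {c : ℝ}
    (hc0 : 0 ≤ c) :
    (∑ i, agreementKernel q r i + fun _ => (r : ℝ)) * testKernel q r k c
      - (k : ℝ) • intEsymm (agreementKernel q r) Finset.univ k ∈ gramKernels (Fin r → Fin q) := by
  have hq' : (2 : ℝ) ≤ q := by exact_mod_cast hq
  have hk' : (1 : ℝ) ≤ k := by exact_mod_cast hk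
  have hr' : (k : ℝ) ≤ r := by exact_mod_cast hr
  have hmem : ∀ m : ℤ, intEsymm (agreementKernel q r) Finset.univ m
      ∈ gramKernels (Fin r → Fin q) := intEsymm_agreementKernel_mem hq
  have h1 := gramKernels.smul_mem (c := ((q : ℝ) - 2) * ((k : ℝ) - 1))
    (mul_nonneg (by linarith) (by linarith)) (hmem (k - 1))
  have h2 := gramKernels.smul_mem (c := ((q : ℝ) - 1) * ((r : ℝ) - k + 2))
    (mul_nonneg (by linarith) (by linarith)) (hmem (k - 2))
  have h3 := mul_mem (sum_mem fun i (_ : i ∈ Finset.univ) => agreementKernel_mem (r := r) hq i)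
    (add_mem (gramKernels.smul_mem hc0 (hmem (k - 2)))
      (gramKernels.smul_mem (c := (q : ℝ) - 1) (by linarith) (hmem (k - 3))))
  have h4 := gramKernels.smul_mem (Nat.cast_nonneg r) (testKernel_mem (r := r) hq k hc0)
  convert add_mem (add_mem (add_mem h1 h2) h3) h4 using 1
  ext p
  have e1 := sum_agreementKernel_mul_intEsymm (q := q) (r := r) p (k - 1)
  rw [show (k : ℤ) - 1 + 1 = k by ring, show (k : ℤ) - 1 - 1 = k - 2 by ring] at e1
  push_cast at e1
  simp only [testKernel, Pi.sub_apply, Pi.mul_apply, Pi.add_apply, Pi.smul_apply, smul_eq_mul]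
  linear_combination e1

theorem card_mul_choose_le (hq : 2 ≤ q) {k : ℕ} (hk : 1 ≤ k) (hr : 2 * k ≤ r) {j : ℝ}
    (hj : j ≤ √(((k : ℝ) - 1) * r / ((q : ℝ) - 1))) {C : Finset (Fin r → Fin q)}
    (hC : IsCodeWithDist q r ((1 - 1 / (q : ℝ)) * ((r : ℝ) - j)) C) :
    (C.card : ℝ) * ((k : ℝ) ^ 2 * (r.choose k * ((q : ℝ) - 1) ^ k))
      ≤ 18 * ((r : ℝ) * ((q : ℝ) - 1)) ^ (2 * k) := by
  have hq' : (2 : ℝ) ≤ q := by exact_mod_cast hq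
  have hk' : (1 : ℝ) ≤ k := by exact_mod_cast hk
  have hr' : 2 * (k : ℝ) ≤ r := by exact_mod_cast hr
  set n : ℝ := (r : ℝ) * ((q : ℝ) - 1) with hn
  have hn1 : 1 ≤ n := by nlinarith
  have hrn : (r : ℝ) ≤ n := by nlinarith
  set A := √(((k : ℝ) - 1) * n) with hA
  have hA0 : 0 ≤ A := Real.sqrt_nonneg _
  have hAA : A * A = ((k : ℝ) - 1) * n :=
    Real.mul_self_sqrt (mul_nonneg (by linarith) (by linarith))
  -- For `k > 1` take `c = A / (k - 1)`, so that `c * A = n`; for `k = 1`, `A = 0` and `c = 0`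
  -- works.
  obtain ⟨c, hc0, hcA, hcn, hcAn⟩ : ∃ c : ℝ, 0 ≤ c ∧ c * ((k : ℝ) - 1) = A ∧ c ≤ n ∧
      c * A ≤ n := by
    rcases hk'.eq_or_lt with h | h
    · refine ⟨0, le_rfl, ?_, by linarith, by linarith⟩
      rw [hA, ← h]
      simp
    · have h2k : (1 : ℝ) ≤ (k : ℝ) - 1 := by
        have h1 : 1 < k := by exact_mod_cast h
        have : (2 : ℝ) ≤ k := by exact_mod_cast h1
        linarith
      have hcAn : A / ((k : ℝ) - 1) * A = n := by
        rw [div_mul_eq_mul_div, hAA, mul_div_cancel_left₀ _ (by linarith)]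
      have hcA' : A / ((k : ℝ) - 1) ≤ A := div_le_self hA0 h2k
      refine ⟨A / ((k : ℝ) - 1), div_nonneg hA0 (by linarith), ?_, ?_, hcAn.le⟩
      · exact div_mul_cancel₀ _ (by linarith)
      · by_contra! hlt
        nlinarith
  have hjA : ((q : ℝ) - 1) * j ≤ A := by
    have h1 : A = ((q : ℝ) - 1) * √(((k : ℝ) - 1) * r / ((q : ℝ) - 1)) := by
      rw [hA, Real.sqrt_eq_iff_mul_self_eq (mul_nonneg (by linarith) (by linarith))
        (mul_nonneg (by linarith) (Real.sqrt_nonneg _))]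
      have h2 := Real.mul_self_sqrt (x := ((k : ℝ) - 1) * r / ((q : ℝ) - 1))
        (div_nonneg (mul_nonneg (by linarith) (by linarith)) (by linarith))
      have h3 : ((q : ℝ) - 1) ≠ 0 := by linarith
      rw [mul_mul_mul_comm, h2, hn]
      field_simp
    rw [h1]
    exact mul_le_mul_of_nonneg_left hj (by linarith)
  set T := ∑ i, agreementKernel q r i with hT
  set g := testKernel q r k c with hg
  set E := intEsymm (agreementKernel q r) Finset.univ (k : ℤ) with hE
  have hEmem : (k : ℝ) • E ∈ gramKernels (Fin r → Fin q) :=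
    gramKernels.smul_mem (by linarith) (intEsymm_agreementKernel_mem hq _)
  have hΦ : ((T - fun _ => A) * g) * ((T + fun _ => (r : ℝ)) * g)
      - (fun _ => (k : ℝ) ^ 2 * (r.choose k * ((q : ℝ) - 1) ^ k))
      ∈ gramKernels (Fin r → Fin q) := by
    have h1 := sub_mul_testKernel_sub_mem hq hk hr hc0 hcA hcAn
    have h2 := add_mul_testKernel_sub_mem hq hk (by omega : k ≤ r) hc0
    have h3 := gramKernels.smul_mem (sq_nonneg (k : ℝ))
      (intEsymm_agreementKernel_sq_sub_mem (r := r) hq k)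
    rw [← hT, ← hg, ← hE] at h1 h2
    rw [← hE] at h3
    -- With `u`, `v` the two Gram remainders and `e = k * E`, this is `(u + e) * (v + e) = u * v + u
    -- * e + e * v + e²`.
    convert add_mem (add_mem (add_mem (mul_mem h1 h2) (mul_mem h1 hEmem)) (mul_mem hEmem h2)) h3
      using 1
    ext p
    simp only [Pi.sub_apply, Pi.mul_apply, Pi.add_apply, Pi.smul_apply, smul_eq_mul, Pi.pow_apply]
    ring
  refine card_mul_le_of_gramKernel hΦ (by positivity) ?_ ?_
  · intro x hx y hy hxy
    have hd := hC x hx y hy hxy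
    have hd' : ((q : ℝ) - 1) * (r - j) ≤ q * hammingDist x y := by
      have := mul_le_mul_of_nonneg_left hd (by linarith : (0 : ℝ) ≤ q)
      rwa [← mul_assoc, mul_sub (q : ℝ), mul_one_div_cancel (by linarith), mul_one] at this
    have hham : (hammingDist x y : ℝ) ≤ r := by
      have := hammingDist_le_card_fintype (x := x) (y := y)
      rw [Fintype.card_fin] at this
      exact_mod_cast this
    have hTv := sum_agreementKernel (x, y)
    rw [← hT] at hTv
    have hTA : T (x, y) - A ≤ 0 := by rw [hTv]; simp only; linarith
    -- The least value of `T` is `-r`, attained when all coordinates differ.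
    have hTr : 0 ≤ T (x, y) + r := by rw [hTv]; simp only; nlinarith
    simp only [Pi.sub_apply, Pi.mul_apply, Pi.add_apply]
    have : (T (x, y) - A) * g (x, y) * ((T (x, y) + r) * g (x, y))
      = (T (x, y) - A) * ((T (x, y) + r) * (g (x, y)) ^ 2) := by ring
    rw [this]
    exact mul_nonpos_of_nonpos_of_nonneg hTA (mul_nonneg hTr (sq_nonneg _))
  · intro x hx
    have hTv := sum_agreementKernel (x, x)
    rw [← hT, hammingDist_self] at hTv
    have hTn : T (x, x) = n := by rw [hTv, hn]; push_cast; ring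
    have hgle := testKernel_diag_le hq (by omega : 1 ≤ r) hk hcn hc0 x
    have hg0 : 0 ≤ g (x, x) := by
      have := gramKernels.sum_nonneg (testKernel_mem (r := r) hq k hc0) {x}
      simpa using this
    rw [← hg, ← hn] at hgle
    have hg2 : g (x, x) ^ 2 ≤ 9 * n ^ (2 * (k - 1)) := by
      calc g (x, x) ^ 2 ≤ (3 * n ^ (k - 1)) ^ 2 := pow_le_pow_left₀ hg0 hgle 2
        _ = _ := by ring
    simp only [Pi.sub_apply, Pi.mul_apply, Pi.add_apply, hTn]
    calc (n - A) * g (x, x) * ((n + r) * g (x, x)) = (n - A) * (n + r) * g (x, x) ^ 2 := by ring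
      _ ≤ n * (n + r) * g (x, x) ^ 2 := by
          gcongr
          linarith
      _ ≤ n * (n + n) * (9 * n ^ (2 * (k - 1))) := by gcongr
      _ = 18 * n ^ (2 * (k - 1) + 2) := by ring
      _ = _ := by rw [show 2 * (k - 1) + 2 = 2 * k by omega]

end UpperBound

theorem exists_maxCodeSize_le {k : ℕ} (hk : 1 ≤ k) {q : ℕ} (hq : 2 ≤ q) :
    ∃ C : ℝ, ∀ r : ℕ, 1 ≤ r → ∀ j : ℝ,
      j ≤ Real.sqrt (((k : ℝ) - 1) * (r : ℝ) / ((q : ℝ) - 1)) →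
        (maxCodeSize q r ((1 - 1 / (q : ℝ)) * ((r : ℝ) - j)) : ℝ) ≤ C * (r : ℝ) ^ k := by
  have hq' : (2 : ℝ) ≤ q := by exact_mod_cast hq
  have hk' : (1 : ℝ) ≤ k := by exact_mod_cast hk
  -- The first summand covers `r < 2 * k` by the trivial bound `q ^ r`; the second covers the rest.
  refine ⟨(q : ℝ) ^ (2 * k) + 18 * 2 ^ k * k.factorial * ((q : ℝ) - 1) ^ k, fun r hr j hj => ?_⟩
  have hr1 : (1 : ℝ) ≤ r := by exact_mod_cast hr
  obtain ⟨C, hC, hcard⟩ := (maxCodeSize_isGreatest q r ((1 - 1 / (q : ℝ)) * ((r : ℝ) - j))).1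
  rw [← hcard, add_mul]
  have hq1 : (0 : ℝ) < ((q : ℝ) - 1) ^ k := pow_pos (by linarith) k
  rcases le_or_gt (2 * k) r with hrk | hrk
  · have h1 := card_mul_choose_le hq hk hrk hj hC
    -- Every factor of the falling factorial is at least `r + 1 - k ≥ r / 2`.
    have h2 : ((r : ℝ) / 2) ^ k ≤ k.factorial * r.choose k := by
      refine le_trans ?_ ((div_le_iff₀' (by positivity)).1 (Nat.pow_le_choose (α := ℝ) k r))
      refine pow_le_pow_left₀ (by positivity) ?_ k
      have h3 : r ≤ (r + 1 - k) * 2 := by omega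
      rw [div_le_iff₀ two_pos]
      exact_mod_cast h3
    have hrp : (0 : ℝ) < (r : ℝ) ^ k := by positivity
    have h4 : (C.card : ℝ) * (((r : ℝ) / 2) ^ k * ((q : ℝ) - 1) ^ k)
        ≤ k.factorial * (18 * ((r : ℝ) * ((q : ℝ) - 1)) ^ (2 * k)) := by
      calc (C.card : ℝ) * (((r : ℝ) / 2) ^ k * ((q : ℝ) - 1) ^ k)
          ≤ C.card * ((k.factorial * r.choose k) * ((q : ℝ) - 1) ^ k) := by gcongr
        _ = k.factorial * (C.card * (1 * (r.choose k * ((q : ℝ) - 1) ^ k))) := by ring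
        _ ≤ k.factorial * (C.card * ((k : ℝ) ^ 2 * (r.choose k * ((q : ℝ) - 1) ^ k))) := by
            gcongr
            exact one_le_pow₀ hk'
        _ ≤ _ := by gcongr
    have h5 : (C.card : ℝ) ≤ 18 * 2 ^ k * k.factorial * ((q : ℝ) - 1) ^ k * (r : ℝ) ^ k := by
      refine le_of_mul_le_mul_right (h4.trans_eq ?_) (mul_pos (pow_pos (by positivity) k) hq1 :
        (0 : ℝ) < ((r : ℝ) / 2) ^ k * ((q : ℝ) - 1) ^ k)
      rw [div_pow, mul_pow, pow_mul', pow_mul']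
      field_simp
    have : (0 : ℝ) ≤ (q : ℝ) ^ (2 * k) * (r : ℝ) ^ k := by positivity
    linarith
  · have h1 : (C.card : ℝ) ≤ (q : ℝ) ^ (2 * k) := by
      have h2 : C.card ≤ q ^ r := by
        have := Finset.card_le_univ C
        simpa using this
      exact_mod_cast h2.trans (Nat.pow_le_pow_right (by omega) hrk.le)
    have h3 : (q : ℝ) ^ (2 * k) ≤ (q : ℝ) ^ (2 * k) * (r : ℝ) ^ k :=
      le_mul_of_one_le_right (by positivity) (one_le_pow₀ hr1)
    have h4 : (0 : ℝ) ≤ 18 * 2 ^ k * k.factorial * ((q : ℝ) - 1) ^ k * (r : ℝ) ^ k := by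
      positivity
    linarith

/-! ### The concatenated code. -/

section Construction

/-- Two distinct affine functions on `F ^ l` agree on at most a `1 / #F` fraction of `F ^ l`. -/
theorem card_affine_agree_mul_le {F : Type*} [Field F] [Fintype F] [DecidableEq F] {l : ℕ}
    {f g : F × (Fin l → F)} (hfg : f ≠ g) :
    (Finset.univ.filter fun v : Fin l → F => f.1 + f.2 ⬝ᵥ v = g.1 + g.2 ⬝ᵥ v).card
      * Fintype.card F ≤ Fintype.card F ^ l := by
  by_cases hu : f.2 = g.2
  · have h1 : f.1 ≠ g.1 := fun h => hfg (Prod.ext h hu)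
    rw [Finset.filter_false_of_mem]
    · simp
    · intro v _ h
      rw [hu] at h
      exact h1 (add_right_cancel h)
  · obtain ⟨i, hi⟩ := Function.ne_iff.1 hu
    have hcard : Fintype.card F ^ l = (Finset.univ : Finset (Fin l → F)).card := by simp
    rw [hcard, ← Finset.card_univ (α := F), ← Finset.card_product]
    -- On each line in direction `i` the two functions agree at most once, so translating agreement
    -- points along this direction is injective.
    refine Finset.card_le_card_of_injOn (fun p => p.1 + Pi.single i p.2)
      (fun _ _ => Finset.mem_coe.2 (Finset.mem_univ _)) ?_
    rintro ⟨v, s⟩ hv ⟨w, t⟩ hw h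
    simp only [Finset.coe_product, Set.mem_prod, Finset.mem_coe, Finset.mem_filter,
      Finset.mem_univ, true_and, and_true] at hv hw h
    have hf := congrArg (fun z => f.2 ⬝ᵥ z) h
    have hg := congrArg (fun z => g.2 ⬝ᵥ z) h
    simp only [dotProduct_add, dotProduct_single] at hf hg
    have hst : (f.2 i - g.2 i) * (s - t) = 0 := by
      linear_combination hf - hg - hv + hw
    have hst' : s = t := by
      rcases mul_eq_zero.1 hst with h0 | h0
      · exact absurd (sub_eq_zero.1 h0) hi
      · exact sub_eq_zero.1 h0
    subst hst'
    simpa using h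

/-- Distinct polynomials of degree less than `k` agree at less than `k` points. -/
theorem card_eval_agree_lt {K : Type*} [Field K] [Fintype K] [DecidableEq K] {k : ℕ}
    {P Q : Polynomial.degreeLT K k} (hPQ : P ≠ Q) :
    (Finset.univ.filter fun a : K => P.1.eval a = Q.1.eval a).card < k := by
  by_contra! hk
  apply hPQ
  ext1
  have h := Polynomial.eq_of_degree_sub_lt_of_eval_finset_eq (f := P.1) (g := Q.1)
    (Finset.univ.filter fun a : K => P.1.eval a = Q.1.eval a) ?_
    (fun a ha => (Finset.mem_filter.1 ha).2)
  · exact h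
  · have := Polynomial.mem_degreeLT.1 (Submodule.sub_mem _ P.2 Q.2)
    exact this.trans_le (by exact_mod_cast hk)

theorem le_maxCodeSize_of_injective {q m : ℕ} {d : ℝ} {W I S : Type*} [Fintype W] [Fintype I]
    [Fintype S] [DecidableEq S] (hI : Fintype.card I = m) (hS : Fintype.card S = q)
    (c : W → I → S) (hc : Function.Injective c)
    (hd : ∀ x y, x ≠ y → d ≤ (hammingDist (c x) (c y) : ℝ)) :
    Fintype.card W ≤ maxCodeSize q m d := by
  classical
  let eI : Fin m ≃ I := (Fintype.equivFinOfCardEq hI).symm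
  let eS : S ≃ Fin q := Fintype.equivFinOfCardEq hS
  let c' : W → Fin m → Fin q := fun w i => eS (c w (eI i))
  have hc' : Function.Injective c' := by
    intro x y h
    apply hc
    ext i
    have := congrFun h (eI.symm i)
    simpa [c'] using this
  have hdist : ∀ x y, hammingDist (c' x) (c' y) = hammingDist (c x) (c y) := by
    intro x y
    unfold hammingDist
    refine Finset.card_equiv eI fun i => ?_
    simp [c']
  refine (maxCodeSize_isGreatest q m d).2 ⟨Finset.univ.image c', ?_, ?_⟩
  · intro x hx y hy hxy
    obtain ⟨x, -, rfl⟩ := Finset.mem_image.1 hx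
    obtain ⟨y, -, rfl⟩ := Finset.mem_image.1 hy
    rw [hdist]
    exact hd x y fun h => hxy (by rw [h])
  · rw [Finset.card_image_of_injective _ hc', Finset.card_univ]

/-- Reed–Solomon codes over the field `K` of order `q ^ (l + 1)`, concatenated with the code of
affine functions on `F ^ l`, where `F` has order `q`. -/
theorem pow_le_maxCodeSize_of_fields {q : ℕ} (hq : 1 < q) {k l : ℕ} (hl : k ≤ q ^ (l + 1))
    (F K : Type) [Field F] [Fintype F] [Field K] [Fintype K] (hF : Fintype.card F = q)
    (hK : Fintype.card K = q ^ (l + 1)) {d : ℝ}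
    (hd : d ≤ (1 - 1 / (q : ℝ)) * (((q ^ (2 * l + 1) : ℕ) : ℝ) - ((k : ℝ) - 1) * (q : ℝ) ^ l)) :
    (q ^ (l + 1)) ^ k ≤ maxCodeSize q (q ^ (2 * l + 1)) d := by
  classical
  have hq1 : (1 : ℝ) < q := by exact_mod_cast hq
  -- Any bijection serves: the inner code only needs distinct symbols to give distinct affine
  -- functions.
  let φ : K ≃ F × (Fin l → F) := Fintype.equivOfCardEq (by
    simp [hF, hK, pow_succ, mul_comm])
  let W := Polynomial.degreeLT K k
  have : Fintype W := Fintype.ofEquiv _ (Polynomial.degreeLTEquiv K k).toEquiv.symm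
  have hW : Fintype.card W = (q ^ (l + 1)) ^ k := by
    rw [Fintype.card_congr (Polynomial.degreeLTEquiv K k).toEquiv]
    simp [hK]
  let c : W → K × (Fin l → F) → F := fun P z =>
    (φ (P.1.eval z.1)).1 + (φ (P.1.eval z.1)).2 ⬝ᵥ z.2
  have hdist : ∀ P Q : W, P ≠ Q → (1 - 1 / (q : ℝ)) *
      (((q ^ (2 * l + 1) : ℕ) : ℝ) - ((k : ℝ) - 1) * (q : ℝ) ^ l)
        ≤ (hammingDist (c P) (c Q) : ℝ) := by
    intro P Q hPQ
    set D := Finset.univ.filter fun a : K => P.1.eval a ≠ Q.1.eval a with hD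
    have hDcard : (q : ℝ) ^ (l + 1) - ((k : ℝ) - 1) ≤ D.card := by
      have h1 := card_eval_agree_lt hPQ
      have h2 := Finset.card_filter_add_card_filter_not (s := (Finset.univ : Finset K))
        (fun a : K => P.1.eval a = Q.1.eval a)
      rw [Finset.card_univ, hK] at h2
      have h3 : q ^ (l + 1) + 1 ≤ D.card + k := by
        simp only [hD, ne_eq]
        omega
      have h4 : (q : ℝ) ^ (l + 1) + 1 ≤ D.card + k := by exact_mod_cast h3
      linarith
    have hinner : ∀ a ∈ D, (1 - 1 / (q : ℝ)) * (q : ℝ) ^ l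
        ≤ ((Finset.univ.filter fun v : Fin l → F => c P (a, v) ≠ c Q (a, v)).card : ℝ) := by
      intro a ha
      have h1 := card_affine_agree_mul_le
        (φ.injective.ne (Finset.mem_filter.1 ha).2)
      have h2 := Finset.card_filter_add_card_filter_not
        (s := (Finset.univ : Finset (Fin l → F))) (fun v => c P (a, v) = c Q (a, v))
      rw [Finset.card_univ, Fintype.card_fun, Fintype.card_fin, hF] at h2
      rw [hF] at h1
      have h1' : ((Finset.univ.filter fun v : Fin l → F => c P (a, v) = c Q (a, v)).card : ℝ)
          ≤ (q : ℝ) ^ l / q := by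
        rw [le_div_iff₀ (by linarith)]
        exact_mod_cast h1
      have h2' : ((Finset.univ.filter fun v : Fin l → F => c P (a, v) = c Q (a, v)).card : ℝ)
          + ((Finset.univ.filter fun v : Fin l → F => c P (a, v) ≠ c Q (a, v)).card : ℝ)
          = (q : ℝ) ^ l := by exact_mod_cast h2
      have : (1 - 1 / (q : ℝ)) * (q : ℝ) ^ l = (q : ℝ) ^ l - (q : ℝ) ^ l / q := by ring
      linarith
    have hham : (hammingDist (c P) (c Q) : ℝ) = ∑ a : K,
        ((Finset.univ.filter fun v : Fin l → F => c P (a, v) ≠ c Q (a, v)).card : ℝ) := by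
      simp only [hammingDist, Finset.card_filter, Fintype.sum_prod_type]
      push_cast
      rfl
    have hfac : 0 ≤ (1 - 1 / (q : ℝ)) * (q : ℝ) ^ l := by
      have : 1 / (q : ℝ) ≤ 1 := by rw [div_le_one (by linarith)]; exact hq1.le
      exact mul_nonneg (by linarith) (by positivity)
    calc (1 - 1 / (q : ℝ)) * (((q ^ (2 * l + 1) : ℕ) : ℝ) - ((k : ℝ) - 1) * (q : ℝ) ^ l)
        = ((q : ℝ) ^ (l + 1) - ((k : ℝ) - 1)) * ((1 - 1 / (q : ℝ)) * (q : ℝ) ^ l) := by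
          push_cast
          ring
      _ ≤ D.card * ((1 - 1 / (q : ℝ)) * (q : ℝ) ^ l) := by gcongr
      _ = ∑ a ∈ D, (1 - 1 / (q : ℝ)) * (q : ℝ) ^ l := by
          rw [Finset.sum_const, nsmul_eq_mul]
      _ ≤ ∑ a ∈ D, ((Finset.univ.filter fun v : Fin l → F =>
            c P (a, v) ≠ c Q (a, v)).card : ℝ) := Finset.sum_le_sum hinner
      _ ≤ _ := by
          rw [hham]
          exact Finset.sum_le_sum_of_subset_of_nonneg (Finset.subset_univ _)
            fun _ _ _ => by positivity
  -- A positive distance bound makes the encoding injective; here `k ≤ q ^ (l + 1)` is needed.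
  have hpos : 0 < (1 - 1 / (q : ℝ)) *
      (((q ^ (2 * l + 1) : ℕ) : ℝ) - ((k : ℝ) - 1) * (q : ℝ) ^ l) := by
    have h1 : 1 / (q : ℝ) < 1 := by rw [div_lt_one (by linarith)]; exact hq1
    have h2 : (k : ℝ) ≤ (q : ℝ) ^ (l + 1) := by exact_mod_cast hl
    have h3 : 0 < (q : ℝ) ^ l := by positivity
    have h4 : ((q ^ (2 * l + 1) : ℕ) : ℝ) = (q : ℝ) ^ (l + 1) * (q : ℝ) ^ l := by
      push_cast
      ring
    rw [h4, ← sub_mul]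
    exact mul_pos (by linarith) (mul_pos (by linarith) h3)
  rw [← hW]
  refine le_maxCodeSize_of_injective ?_ hF c ?_ fun P Q h => hd.trans (hdist P Q h)
  · simp [hF, hK]
    ring
  · intro P Q h
    by_contra hPQ
    have := hdist P Q hPQ
    rw [h, hammingDist_self] at this
    push_cast at this hpos
    linarith

theorem pow_le_maxCodeSize {q : ℕ} (hq : IsPrimePow q) {k l : ℕ}
    (hl : k ≤ q ^ (l + 1)) {d : ℝ}
    (hd : d ≤ (1 - 1 / (q : ℝ)) * (((q ^ (2 * l + 1) : ℕ) : ℝ) - ((k : ℝ) - 1) * (q : ℝ) ^ l)) :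
    (q ^ (l + 1)) ^ k ≤ maxCodeSize q (q ^ (2 * l + 1)) d := by
  have hq1 := hq.one_lt
  obtain ⟨p, n, hp, hn, hpn⟩ := hq
  have : Fact p.Prime := ⟨hp.nat_prime⟩
  have : Fintype (GaloisField p n) := Fintype.ofFinite _
  have : Fintype (GaloisField p (n * (l + 1))) := Fintype.ofFinite _
  refine pow_le_maxCodeSize_of_fields hq1 hl (GaloisField p n) (GaloisField p (n * (l + 1)))
    ?_ ?_ hd
  · rw [← Nat.card_eq_fintype_card, GaloisField.card p n hn.ne', hpn]
  · rw [← Nat.card_eq_fintype_card, GaloisField.card p _ (by positivity), pow_mul, hpn]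

end Construction

theorem infinite_setOf_rpow_le_maxCodeSize (k : ℕ) {q : ℕ} (hq : IsPrimePow q) :
    {r : ℕ | ∀ j : ℝ, ((k : ℝ) - 1) * Real.sqrt ((r : ℝ) / (q : ℝ)) ≤ j →
      ((r : ℝ) * (q : ℝ)) ^ ((k : ℝ) / 2) ≤
        (maxCodeSize q r ((1 - 1 / (q : ℝ)) * ((r : ℝ) - j)) : ℝ)}.Infinite := by
  have hq1 : 1 < q := hq.one_lt
  have hq1' : (1 : ℝ) < q := by exact_mod_cast hq1
  refine Set.infinite_of_injective_forall_mem (f := fun t : ℕ => q ^ (2 * (k + t) + 1)) ?_ ?_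
  · intro s t h
    have := Nat.pow_right_injective hq1 h
    omega
  · intro t j hj
    -- Starting at `k` ensures `k ≤ q ^ (l + 1)` for every `t`.
    set l := k + t with hl
    have hsqrt : Real.sqrt (((q ^ (2 * l + 1) : ℕ) : ℝ) / q) = (q : ℝ) ^ l := by
      rw [Real.sqrt_eq_iff_mul_self_eq_of_pos (by positivity)]
      push_cast
      field_simp
      ring
    have hpow : (((q ^ (2 * l + 1) : ℕ) : ℝ) * q) ^ ((k : ℝ) / 2)
        = (((q ^ (l + 1)) ^ k : ℕ) : ℝ) := by
      have h1 : ((q ^ (2 * l + 1) : ℕ) : ℝ) * q = ((q : ℝ) ^ (l + 1)) ^ (2 : ℝ) := by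
        rw [Real.rpow_two]
        push_cast
        ring
      rw [h1, ← Real.rpow_mul (by positivity), mul_div_cancel₀ _ two_ne_zero,
        Real.rpow_natCast]
      push_cast
      rfl
    rw [hpow]
    rw [hsqrt] at hj
    refine Nat.cast_le.2 (pow_le_maxCodeSize hq ?_ ?_)
    · exact (Nat.lt_pow_self hq1).le.trans (Nat.pow_le_pow_right hq1.le (by omega))
    · have : 1 / (q : ℝ) ≤ 1 := by rw [div_le_one (by linarith)]; exact hq1'.le
      exact mul_le_mul_of_nonneg_left (by linarith) (by linarith)

theorem theorem3 (k : ℕ) (hk : 1 ≤ k) :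
    (∀ q : ℕ, 2 ≤ q → ∃ C : ℝ, ∀ r : ℕ, 1 ≤ r → ∀ j : ℝ,
      j ≤ Real.sqrt (((k : ℝ) - 1) * (r : ℝ) / ((q : ℝ) - 1)) →
        (maxCodeSize q r ((1 - 1 / (q : ℝ)) * ((r : ℝ) - j)) : ℝ) ≤ C * (r : ℝ) ^ k) ∧
    (∀ q : ℕ, IsPrimePow q →
      {r : ℕ | ∀ j : ℝ, ((k : ℝ) - 1) * Real.sqrt ((r : ℝ) / (q : ℝ)) ≤ j →
        ((r : ℝ) * (q : ℝ)) ^ ((k : ℝ) / 2) ≤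
          (maxCodeSize q r ((1 - 1 / (q : ℝ)) * ((r : ℝ) - j)) : ℝ)}.Infinite) :=
  ⟨fun _ hq => exists_maxCodeSize_le hk hq,
    fun _ hq => infinite_setOf_rpow_le_maxCodeSize k hq⟩
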